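/- Let $M$ and $N\ge 2$ be integers and let $A\in\mathbb{C}^{M\times N}$ be a matrix with nonzero columns $a_1,\dots,a_N$; put $d_j=\|a_j\|_2$. Let $\sigma>0$ and $\alpha>0$, let $v=(v_1,\dots,v_M)^T$ be a random vector with independent entries $v_i\sim\mathcal{CN}(0,\sigma^2)$ (that is, the real and imaginary parts of $v_i$ are independent real Gaussians with mean $0$ and variance $\sigma^2/2$), and set $\rho=\sigma\sqrt{2(1+\alpha)\log N}$. Then the event $$E=\Big\{\max_{1\le j\le N}\frac{|a_j^* v|}{d_j}<\rho\Big\}$$ satisfies $$\Pr\{E\}\;\ge\;\left(1-\sqrt{\frac{2}{\pi}}\,\sqrt{\frac{\sigma}{\rho}}\,\exp\!\Big(-\frac{\rho^2}{2\sigma^2}\Big)\right)^{2N}.$$ -/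

import Mathlib

open MeasureTheory ProbabilityTheory
open scoped NNReal Matrix

noncomputable section

/-- The circularly symmetric complex Gaussian distribution `CN(0, s)` with mean zero and variance
`s`: the real and imaginary parts are independent real Gaussians with mean `0` and variance
`s / 2`. -/
def complexGaussian (s : ℝ≥0) : Measure ℂ :=
  ((gaussianReal 0 (s / 2)).prod (gaussianReal 0 (s / 2))).map
    Complex.measurableEquivRealProd.symm

/-- The Euclidean norm `d_j = ‖a_j‖₂` of the `j`-th column of `A`. -/
def colNorm {M N : ℕ} (A : Matrix (Fin M) (Fin N) ℂ) (j : Fin N) : ℝ :=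
  ‖WithLp.toLp 2 (A.col j)‖

/-- The threshold `ρ = σ √(2 (1 + α) log N)`. -/
def rho (σ α : ℝ) (N : ℕ) : ℝ :=
  σ * √(2 * (1 + α) * Real.log N)

/-- The event `E = {max_j |a_j^* v| / d_j < r}` (the supremum is a maximum, since there are
finitely many columns). -/
def noiseEvent {Ω : Type*} {M N : ℕ} (A : Matrix (Fin M) (Fin N) ℂ) (v : Fin M → Ω → ℂ)
    (r : ℝ) : Set Ω :=
  {ω | ⨆ j : Fin N, ‖star (A.col j) ⬝ᵥ (fun i => v i ω)‖ / colNorm A j < r}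

end

/-! Each `a_j^* v / d_j` is again `CN(0, σ²)`, so with `t = ρ / σ` its modulus reaches `ρ` with
probability exactly `exp (-t²)`. A union bound gives `P(E) ≥ 1 - N exp (-t²)`; no correlation
inequality between columns is needed. The product bound is weaker: for `q = exp (-t²/2)` it loses
about `2 N √(2/π) √(1/t) q`, while the union bound loses only `N q²`, and `t² ≥ 2 log N` gives `N q
≤ 1`. `one_sub_sqrt_mul_exp_pow_le` makes this precise. -/

instance isProbabilityMeasure_complexGaussian (s : ℝ≥0) :
    IsProbabilityMeasure (complexGaussian s) :=
  Measure.isProbabilityMeasure_map (by fun_prop)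

/-- Dependence on `‖z‖` alone encodes circular symmetry; laws of multiples and sums are identified
through this formula. -/
theorem charFun_complexGaussian (s : ℝ≥0) (z : ℂ) :
    charFun (complexGaussian s) z = Complex.exp (-(s * ‖z‖ ^ 2 / 4 : ℝ)) := by
  have h : ∀ p : ℝ × ℝ,
      Complex.exp ((inner ℝ (Complex.measurableEquivRealProd.symm p) z : ℝ) * Complex.I) =
        Complex.exp (z.re * p.1 * Complex.I) * Complex.exp (z.im * p.2 * Complex.I) := by
    intro p
    rw [← Complex.exp_add]
    congr 1
    simp [Complex.inner, Complex.measurableEquivRealProd_symm_apply]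
    ring
  rw [charFun_apply, complexGaussian, integral_map_equiv]
  simp_rw [h]
  rw [integral_prod_mul (fun x : ℝ => Complex.exp (z.re * x * Complex.I))
    (fun x : ℝ => Complex.exp (z.im * x * Complex.I)), ← charFun_apply_real, ← charFun_apply_real,
    charFun_gaussianReal, charFun_gaussianReal, ← Complex.exp_add]
  congr 1
  rw [← Complex.normSq_eq_norm_sq, Complex.normSq_apply]
  push_cast
  ring

/-! ### Exact tail of the modulus -/

theorem setLIntegral_Ici_mul_exp_neg_sq {v : ℝ} (hv : 0 < v) {r : ℝ} (hr : 0 ≤ r) :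
    ∫⁻ x in Set.Ici r, ENNReal.ofReal (x * (v⁻¹ * Real.exp (-x ^ 2 / (2 * v)))) =
      ENNReal.ofReal (Real.exp (-r ^ 2 / (2 * v))) := by
  have hderiv : ∀ x ∈ Set.Ici r, HasDerivAt (fun x => -Real.exp (-x ^ 2 / (2 * v)))
      (x * (v⁻¹ * Real.exp (-x ^ 2 / (2 * v)))) x := by
    intro x _
    have h := (((hasDerivAt_pow 2 x).neg.div_const (2 * v)).exp).neg
    convert! h using 1
    simp
    field_simp
  have hpos : ∀ x ∈ Set.Ioi r, 0 ≤ x * (v⁻¹ * Real.exp (-x ^ 2 / (2 * v))) := by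
    intro x hx
    have : 0 ≤ x := hr.trans hx.le
    positivity
  have hlim : Filter.Tendsto (fun x : ℝ => -Real.exp (-x ^ 2 / (2 * v))) Filter.atTop
      (nhds 0) := by
    rw [← neg_zero]
    refine (Real.tendsto_exp_atBot.comp ?_).neg
    simp_rw [neg_div]
    exact Filter.tendsto_neg_atTop_atBot.comp
      ((Filter.tendsto_pow_atTop two_ne_zero).atTop_div_const (by positivity))
  rw [setLIntegral_congr Ioi_ae_eq_Ici.symm, ← ofReal_integral_eq_lintegral_ofReal
    (integrableOn_Ioi_deriv_of_nonneg' hderiv hpos hlim)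
    ((ae_restrict_iff' measurableSet_Ioi).2 (ae_of_all _ hpos)),
    integral_Ioi_of_hasDerivAt_of_nonneg' hderiv hpos hlim]
  simp

theorem gaussianReal_prod_gaussianReal_le_sq_add_sq {v : ℝ≥0} (hv : v ≠ 0) {r : ℝ} (hr : 0 ≤ r) :
    ((gaussianReal 0 v).prod (gaussianReal 0 v)) {p | r ^ 2 ≤ p.1 ^ 2 + p.2 ^ 2} =
      ENNReal.ofReal (Real.exp (-r ^ 2 / (2 * v))) := by
  have hv' : (0 : ℝ) < v := by positivity
  have hS : MeasurableSet {p : ℝ × ℝ | r ^ 2 ≤ p.1 ^ 2 + p.2 ^ 2} :=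
    measurableSet_le (by fun_prop) (by fun_prop)
  have hpdf : ∀ p : ℝ × ℝ, gaussianPDF 0 v p.1 * gaussianPDF 0 v p.2 =
      ENNReal.ofReal ((2 * Real.pi)⁻¹ * (((v : ℝ))⁻¹ *
        Real.exp (-(p.1 ^ 2 + p.2 ^ 2) / (2 * v)))) := by
    intro p
    rw [gaussianPDF, gaussianPDF, ← ENNReal.ofReal_mul (gaussianPDFReal_nonneg _ _ _)]
    congr 1
    simp only [gaussianPDFReal, sub_zero]
    rw [mul_mul_mul_comm, ← Real.exp_add, ← mul_inv, Real.mul_self_sqrt (by positivity), mul_inv,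
      mul_assoc]
    congr 4
    ring
  -- The polar Jacobian turns the radial density into an exact derivative; the angle contributes
  -- only the constant `1 / (2π)`.
  have hpolar : ∀ p ∈ polarCoord.target, ENNReal.ofReal p.1 •
      ({p : ℝ × ℝ | r ^ 2 ≤ p.1 ^ 2 + p.2 ^ 2}.indicator (fun p : ℝ × ℝ =>
        ENNReal.ofReal ((2 * Real.pi)⁻¹ * (((v : ℝ))⁻¹ *
        Real.exp (-(p.1 ^ 2 + p.2 ^ 2) / (2 * v))))) (polarCoord.symm p)) =
      (Set.Ici r).indicator
        (fun x => ENNReal.ofReal (x * ((v : ℝ)⁻¹ * Real.exp (-x ^ 2 / (2 * v))))) p.1 *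
        ENNReal.ofReal (2 * Real.pi)⁻¹ := by
    intro p hp
    have hp1 : 0 < p.1 := hp.1
    have hsq : (polarCoord.symm p).1 ^ 2 + (polarCoord.symm p).2 ^ 2 = p.1 ^ 2 := by
      simp only [polarCoord_symm_apply]
      linear_combination p.1 ^ 2 * Real.sin_sq_add_cos_sq p.2
    by_cases h : r ≤ p.1
    · rw [Set.indicator_of_mem (by rwa [Set.mem_ofPred_eq, hsq, sq_le_sq₀ hr hp1.le]),
        Set.indicator_of_mem (by simpa using h), hsq, smul_eq_mul,
        ← ENNReal.ofReal_mul hp1.le, ← ENNReal.ofReal_mul (by positivity)]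
      congr 1
      ring
    · rw [Set.indicator_of_notMem, Set.indicator_of_notMem (by simpa using h)]
      · simp
      · rw [Set.mem_ofPred_eq, hsq, sq_le_sq₀ hr hp1.le]
        exact h
  rw [gaussianReal_of_var_ne_zero _ hv, prod_withDensity (by fun_prop) (by fun_prop),
    withDensity_apply _ hS, ← lintegral_indicator hS]
  simp_rw [hpdf]
  rw [← Measure.volume_eq_prod, ← lintegral_comp_polarCoord_symm,
    setLIntegral_congr_fun polarCoord.open_target.measurableSet hpolar,
    polarCoord_target, Measure.volume_eq_prod, ← Measure.prod_restrict,
    lintegral_prod_mul (f := (Set.Ici r).indicator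
        (fun x => ENNReal.ofReal (x * ((v : ℝ)⁻¹ * Real.exp (-x ^ 2 / (2 * v))))))
      (g := fun _ => ENNReal.ofReal (2 * Real.pi)⁻¹)
      ((Measurable.indicator (by fun_prop) measurableSet_Ici).aemeasurable) (by fun_prop),
    ← setLIntegral_congr Ioi_ae_eq_Ici.symm, lintegral_indicator measurableSet_Ici,
    Measure.restrict_restrict measurableSet_Ici, Set.inter_eq_left.2 (Set.Ici_subset_Ici.2 hr),
    setLIntegral_Ici_mul_exp_neg_sq hv' hr, lintegral_const, Measure.restrict_apply_univ,
    Real.volume_Ioo, ← ENNReal.ofReal_mul (by positivity)]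
  rw [show (2 * Real.pi)⁻¹ * (Real.pi - -Real.pi) = 1 by field_simp; ring]
  simp

theorem complexGaussian_real_le_norm {s : ℝ≥0} (hs : s ≠ 0) {r : ℝ} (hr : 0 ≤ r) :
    (complexGaussian s).real {z | r ≤ ‖z‖} = Real.exp (-r ^ 2 / s) := by
  have h : Complex.measurableEquivRealProd.symm ⁻¹' {z | r ≤ ‖z‖} =
      {p | r ^ 2 ≤ p.1 ^ 2 + p.2 ^ 2} := by
    ext p
    rw [Set.mem_preimage, Set.mem_ofPred_eq, Set.mem_ofPred_eq, ← sq_le_sq₀ hr (norm_nonneg _),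
      ← Complex.normSq_eq_norm_sq, Complex.normSq_apply, Complex.measurableEquivRealProd_symm_apply,
      ← sq, ← sq]
  rw [measureReal_def, complexGaussian, MeasurableEquiv.map_apply, h,
    gaussianReal_prod_gaussianReal_le_sq_add_sq (by simpa using hs) hr,
    ENNReal.toReal_ofReal (Real.exp_nonneg _)]
  congr 2
  push_cast
  ring

/-! ### Linear combinations of complex Gaussians -/

theorem hasLaw_complexGaussian_const_mul {Ω : Type*} [MeasurableSpace Ω] {P : Measure Ω}
    [IsProbabilityMeasure P] {s : ℝ≥0} {X : Ω → ℂ} (hX : HasLaw X (complexGaussian s) P) (c : ℂ) :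
    HasLaw (fun ω => c * X ω) (complexGaussian (‖c‖₊ ^ 2 * s)) P where
  aemeasurable := hX.aemeasurable.const_mul c
  map_eq := by
    have hm : AEMeasurable (fun ω => c * X ω) P := hX.aemeasurable.const_mul c
    have := Measure.isProbabilityMeasure_map hm
    refine Measure.ext_of_charFun ?_
    ext z
    have h := charFun_complexGaussian s ((starRingEnd ℂ) c * z)
    rw [← hX.map_eq, charFun_apply, integral_map hX.aemeasurable (by fun_prop)] at h
    rw [charFun_apply, integral_map hm (by fun_prop), charFun_complexGaussian]
    -- For the real inner product on `ℂ`, the adjoint of multiplication by `c` is multiplication by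
    -- its conjugate.
    convert h using 2
    · ext ω
      simp only [Complex.inner, map_mul]
      ring_nf
    · simp
      ring

theorem hasLaw_complexGaussian_sum {Ω ι : Type*} [Fintype ι] [MeasurableSpace Ω] {P : Measure Ω}
    [IsProbabilityMeasure P] {s : ι → ℝ≥0} {X : ι → Ω → ℂ}
    (hX : ∀ i, HasLaw (X i) (complexGaussian (s i)) P) (hi : iIndepFun X P) :
    HasLaw (fun ω => ∑ i, X i ω) (complexGaussian (∑ i, s i)) P where
  aemeasurable := Finset.aemeasurable_fun_sum _ fun i _ => (hX i).aemeasurable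
  map_eq := by
    have := Measure.isProbabilityMeasure_map (μ := P) (f := fun ω => ∑ i, X i ω)
      (Finset.aemeasurable_fun_sum _ fun i _ => (hX i).aemeasurable)
    refine Measure.ext_of_charFun ?_
    rw [iIndepFun.charFun_map_fun_sum_eq_prod (fun i => (hX i).aemeasurable) hi]
    ext z
    simp_rw [Finset.prod_apply, (hX _).map_eq, charFun_complexGaussian]
    rw [← Complex.exp_sum]
    congr 1
    push_cast
    rw [Finset.sum_neg_distrib, Finset.sum_mul, Finset.sum_div]

theorem hasLaw_complexGaussian_star_dotProduct {Ω ι : Type*} [Fintype ι] [MeasurableSpace Ω]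
    {P : Measure Ω} [IsProbabilityMeasure P] {s : ℝ≥0} {v : ι → Ω → ℂ}
    (hv : ∀ i, HasLaw (v i) (complexGaussian s) P) (hi : iIndepFun v P) (a : ι → ℂ) :
    HasLaw (fun ω => star a ⬝ᵥ fun i => v i ω)
      (complexGaussian (‖WithLp.toLp 2 a‖₊ ^ 2 * s)) P := by
  have h := hasLaw_complexGaussian_sum
    (fun i => hasLaw_complexGaussian_const_mul (hv i) (star (a i)))
    (hi.comp (fun i z => star (a i) * z) fun i => measurable_const_mul _)
  rw [← Finset.sum_mul] at h
  have hnorm : ‖WithLp.toLp 2 a‖₊ ^ 2 = ∑ i, ‖star (a i)‖₊ ^ 2 :=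
    NNReal.eq (by simp [EuclideanSpace.norm_sq_eq])
  rw [hnorm]
  exact h

theorem measureReal_le_norm_star_dotProduct_div {Ω ι : Type*} [Fintype ι] [MeasurableSpace Ω]
    {P : Measure Ω} [IsProbabilityMeasure P] {s : ℝ≥0} (hs : s ≠ 0) {v : ι → Ω → ℂ}
    (hv : ∀ i, HasLaw (v i) (complexGaussian s) P) (hi : iIndepFun v P) {a : ι → ℂ} (ha : a ≠ 0)
    {r : ℝ} (hr : 0 ≤ r) :
    P.real {ω | r ≤ ‖star a ⬝ᵥ fun i => v i ω‖ / ‖WithLp.toLp 2 a‖} = Real.exp (-r ^ 2 / s) := by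
  have hd : 0 < ‖WithLp.toLp 2 a‖ := by simpa using ha
  simp_rw [le_div_iff₀ hd]
  rw [(hasLaw_complexGaussian_star_dotProduct hv hi a).measureReal_eq
    (p := fun z => r * ‖WithLp.toLp 2 a‖ ≤ ‖z‖) (measurableSet_le (by fun_prop) (by fun_prop)),
    complexGaussian_real_le_norm (mul_ne_zero (by simpa using ha) hs) (by positivity)]
  congr 1
  push_cast
  have : (s : ℝ) ≠ 0 := by simpa using hs
  field_simp

/-! ### Deterministic comparison of the two bounds -/

/-- In terms of `t = ρ / σ`, the lower bound of the main theorem is weaker than the union bound. -/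
theorem one_sub_sqrt_mul_exp_pow_le {t : ℝ} {N : ℕ} (hN : 2 ≤ N)
    (ht : 2 * Real.log N ≤ t ^ 2) (ht0 : 0 < t) :
    (1 - √(2 / Real.pi) * √(1 / t) * Real.exp (-t ^ 2 / 2)) ^ (2 * N) ≤
      1 - N * Real.exp (-t ^ 2) := by
  have hN' : (2 : ℝ) ≤ N := by exact_mod_cast hN
  have hlog2 : 0.6931471803 < Real.log 2 := Real.log_two_gt_d9
  have hlog : Real.log 2 ≤ Real.log N := Real.log_le_log (by norm_num) hN'
  have ht1 : 1 ≤ t := by nlinarith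
  set s := √(1 / t) with hs
  set c := √(2 / Real.pi) with hc
  set q := Real.exp (-t ^ 2 / 2) with hq
  have hs0 : 0 < s := by positivity
  have hs2 : s ^ 2 * t = 1 := by rw [hs, Real.sq_sqrt (by positivity)]; field_simp
  have hs1 : s ≤ 1 := by nlinarith
  have hc0 : 0.79 ≤ c := by
    refine Real.le_sqrt_of_sq_le ?_
    rw [le_div_iff₀ Real.pi_pos]
    nlinarith [Real.pi_lt_d4]
  have hc1 : c ≤ 1 := by
    rw [hc, Real.sqrt_le_one, div_le_one Real.pi_pos]
    linarith [Real.pi_gt_three]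
  have hq0 : 0 < q := Real.exp_pos _
  have hq1 : q ≤ 1 := Real.exp_le_one_iff.2 (by nlinarith)
  have hqq : Real.exp (-t ^ 2) = q ^ 2 := by
    rw [hq, ← Real.exp_nat_mul]
    congr 1
    push_cast
    ring
  have hNq : N * q ≤ 1 := by
    rw [← Real.exp_log (show (0 : ℝ) < N by positivity), hq, ← Real.exp_add]
    exact Real.exp_le_one_iff.2 (by linarith)
  have hqt : q * (1 + t ^ 2 / 2 + t ^ 4 / 8) ≤ 1 := by
    have h := Real.quadratic_le_exp_of_nonneg (show 0 ≤ t ^ 2 / 2 by positivity)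
    have h2 : q * Real.exp (t ^ 2 / 2) = 1 := by
      rw [hq, ← Real.exp_add, ← Real.exp_zero]; congr 1; ring
    calc q * (1 + t ^ 2 / 2 + t ^ 4 / 8) ≤ q * Real.exp (t ^ 2 / 2) := by
          gcongr; linarith
      _ = 1 := h2
  set x := c * s * q with hx
  have hx0 : 0 < x := by positivity
  have hx1 : x ≤ 1 := mul_le_one₀ (mul_le_one₀ hc1 hs0.le hs1) hq0.le hq1
  have hpow : (1 - x) ^ (2 * N) ≤ Real.exp (-(2 * N * x)) := by
    calc (1 - x) ^ (2 * N) ≤ Real.exp (-x) ^ (2 * N) :=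
          pow_le_pow_left₀ (by linarith) (Real.one_sub_le_exp_neg x) _
      _ = Real.exp (-(2 * N * x)) := by
          rw [← Real.exp_nat_mul]; congr 1; push_cast; ring
  have hinv : Real.exp (-(2 * N * x)) ≤ (1 + 2 * N * x)⁻¹ := by
    rw [Real.exp_neg]
    refine inv_anti₀ (by positivity) ?_
    linarith [Real.add_one_le_exp (2 * N * x)]
  rw [hqq]
  refine hpow.trans (hinv.trans ?_)
  rw [inv_le_iff_one_le_mul₀ (by positivity)]
  have hcs : 0.79 * s ≤ c * s := by gcongr
  -- What remains after clearing the denominator, dividing by `N q` and using `N q ≤ 1`. It follows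
  -- from the Taylor bound `hqt` on `q`.
  have hkey : q * (1 + 2 * (c * s)) ≤ 2 * (c * s) := by
    -- `1.17² < 2 log 2 ≤ t²`.
    have ht2 : 1.17 ≤ t := by nlinarith
    have hst : 1 ≤ s * t := by nlinarith
    have hW : 1 ≤ 2 * (c * s) * (t ^ 2 / 2 + t ^ 4 / 8) := by
      calc (1 : ℝ) ≤ 2 * 0.79 * (1 * (1.17 / 2 + 1.17 ^ 3 / 8)) := by norm_num
        _ ≤ 2 * 0.79 * (s * t * (t / 2 + t ^ 3 / 8)) := by gcongr
        _ = 2 * (0.79 * s) * (t ^ 2 / 2 + t ^ 4 / 8) := by ring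
        _ ≤ 2 * (c * s) * (t ^ 2 / 2 + t ^ 4 / 8) := by gcongr
    calc q * (1 + 2 * (c * s))
        ≤ q * (2 * (c * s) * (t ^ 2 / 2 + t ^ 4 / 8) + 2 * (c * s)) := by gcongr
      _ = 2 * (c * s) * (q * (1 + t ^ 2 / 2 + t ^ 4 / 8)) := by ring
      _ ≤ 2 * (c * s) * 1 := by gcongr
      _ = 2 * (c * s) := mul_one _
  have hexp : (1 - N * q ^ 2) * (1 + 2 * N * x) - 1 =
      N * q * (2 * (c * s) - q - N * q * (2 * (c * s)) * q) := by rw [hx]; ring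
  have h3 : N * q * (2 * (c * s) * q) ≤ 1 * (2 * (c * s) * q) := by gcongr
  have h4 : 0 ≤ N * q * (2 * (c * s) - q - N * q * (2 * (c * s)) * q) := by
    apply mul_nonneg (by positivity); linarith
  linarith

/-! ### Union bound and conclusion -/

theorem one_sub_sum_le_measureReal_noiseEvent {Ω : Type*} [MeasurableSpace Ω] {P : Measure Ω}
    [IsProbabilityMeasure P] {M N : ℕ} [NeZero N] (A : Matrix (Fin M) (Fin N) ℂ)
    (v : Fin M → Ω → ℂ) (r : ℝ) :
    1 - ∑ j, P.real {ω | r ≤ ‖star (A.col j) ⬝ᵥ fun i => v i ω‖ / colNorm A j} ≤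
      P.real (noiseEvent A v r) := by
  have hcover : (Set.univ : Set Ω) ⊆ noiseEvent A v r ∪
      ⋃ j, {ω | r ≤ ‖star (A.col j) ⬝ᵥ fun i => v i ω‖ / colNorm A j} := by
    intro ω _
    by_cases h : ω ∈ noiseEvent A v r
    · exact Or.inl h
    · right
      -- The supremum is attained because `Fin N` is finite and nonempty, so some column reaches
      -- `r`.
      obtain ⟨j, hj⟩ := exists_eq_ciSup_of_finite
        (f := fun j => ‖star (A.col j) ⬝ᵥ fun i => v i ω‖ / colNorm A j)
      exact Set.mem_iUnion.2 ⟨j, (not_lt.1 h).trans_eq hj.symm⟩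
  have h := (measureReal_mono (μ := P) hcover).trans (measureReal_union_le _ _)
  rw [probReal_univ] at h
  have h2 := measureReal_iUnion_fintype_le (μ := P)
    fun j => {ω | r ≤ ‖star (A.col j) ⬝ᵥ fun i => v i ω‖ / colNorm A j}
  linarith

theorem lemma1 {Ω : Type*} [MeasurableSpace Ω] (P : Measure Ω) [IsProbabilityMeasure P]
    {M N : ℕ} (hN : 2 ≤ N)
    (A : Matrix (Fin M) (Fin N) ℂ) (hA : ∀ j, A.col j ≠ 0)
    (σ α : ℝ) (hσ : 0 < σ) (hα : 0 < α)
    (v : Fin M → Ω → ℂ)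
    (hv_law : ∀ i, HasLaw (v i) (complexGaussian (σ ^ 2).toNNReal) P)
    (hv_indep : iIndepFun v P) :
    (1 - √(2 / Real.pi) * √(σ / rho σ α N)
        * Real.exp (-(rho σ α N) ^ 2 / (2 * σ ^ 2))) ^ (2 * N)
      ≤ P.real (noiseEvent A v (rho σ α N)) := by
  have : NeZero N := ⟨by omega⟩
  have hlog : 0 < Real.log N := Real.log_pos (by exact_mod_cast hN)
  set t := √(2 * (1 + α) * Real.log N) with ht
  have ht0 : 0 < t := by positivity
  have hρ : rho σ α N = σ * t := rfl
  have ht2 : 2 * Real.log N ≤ t ^ 2 := by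
    rw [ht, Real.sq_sqrt (by positivity)]
    nlinarith
  have htail : ∀ j, P.real {ω | rho σ α N ≤
      ‖star (A.col j) ⬝ᵥ fun i => v i ω‖ / colNorm A j} = Real.exp (-t ^ 2) := by
    intro j
    refine (measureReal_le_norm_star_dotProduct_div (Real.toNNReal_pos.2 (by positivity)).ne'
      hv_law hv_indep (hA j) (by rw [hρ]; positivity)).trans ?_
    rw [Real.coe_toNNReal _ (by positivity), hρ]
    congr 1
    field_simp
  have hunion := one_sub_sum_le_measureReal_noiseEvent (P := P) A v (rho σ α N)
  simp only [htail, Finset.sum_const, Finset.card_univ, Fintype.card_fin, nsmul_eq_mul] at hunion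
  refine le_trans (le_of_eq ?_) ((one_sub_sqrt_mul_exp_pow_le hN ht2 ht0).trans hunion)
  rw [hρ, show σ / (σ * t) = 1 / t by field_simp,
    show -(σ * t) ^ 2 / (2 * σ ^ 2) = -t ^ 2 / 2 by field_simp]
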